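/- Consider $n \ge 1$ agents $[n]$ and $m$ indivisible goods $[m]$; agent $i$ has a valuation $v_i : 2^{[m]} \to \mathbb{R}_{\ge 0}$. A valuation $v$ is XOS if there is a family $\mathcal F$ of additive functions with nonnegative weights such that $v(S) = \max_{f \in \mathcal F} f(S)$ for all $S \subseteq [m]$; it is binary XOS if moreover $v(S \cup \{g\}) - v(S) \in \{0,1\}$ for all $S \subseteq [m]$ and $g \in [m] \setminus S$. The AnyPrice share of agent $i$ (with equal entitlements) is $$\mathrm{APS}_i = \min_{p} \; \max_{S \subseteq [m] :\ \sum_{g \in S} p_g \le 1/n} v_i(S),$$ where $p$ ranges over the price vectors in $\mathbb{R}_{\ge 0}^m$ with $\sum_{g \in [m]} p_g = 1$ (and $\mathrm{APS}_i = 0$ if $m = 0$). An allocation is a partition of $[m]$ into bundles $A_1, \dots, A_n$, possibly empty, and it is $\alpha$-APS if $v_i(A_i) \ge \alpha \cdot \mathrm{APS}_i$ for every agent $i$. 1. There is an algorithm that, given $n$, $m$ and access to the valuations $v_1, \dots, v_n$ through a value oracle (a query names an agent $i$ and a set $S \subseteq [m]$ and is answered by $v_i(S)$), computes a $0.1222$-APS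 allocation in time polynomial in $n + m$, for all $n \ge 1$, all $m$, and all binary XOS valuations $v_1, \dots, v_n$. 2. There is an instance in which all agents have the same binary XOS valuation and no allocation is $\alpha$-APS for any $\alpha > 1/2$. -/

import Mathlib

namespace FairDivision

noncomputable section

/-! ### Valuations, the AnyPrice share, allocations -/

/-- A set function on the goods `[m]`, the type of a valuation. -/
abbrev Valuation (m : ℕ) : Type := Finset (Fin m) → ℝ

/-- `v` is XOS: there is a family `F` of additive functions with nonnegative weights such that
`v S = max_{f ∈ F} f S` for every set `S` of goods (the maximum being attained). -/
def IsXOS {m : ℕ} (v : Valuation m) : Prop :=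
  ∃ F : Set (Fin m → ℝ), (∀ f ∈ F, ∀ g, 0 ≤ f g) ∧
    ∀ S : Finset (Fin m), IsGreatest ((fun f : Fin m → ℝ => ∑ g ∈ S, f g) '' F) (v S)

/-- Every good adds either `0` or `1` to the value of every set that does not contain it. -/
def HasBinaryMarginals {m : ℕ} (v : Valuation m) : Prop :=
  ∀ (S : Finset (Fin m)) (g : Fin m), g ∉ S →
    v (insert g S) - v S = 0 ∨ v (insert g S) - v S = 1

/-- Binary XOS valuations: XOS functions with binary marginals. -/
def IsBinaryXOS {m : ℕ} (v : Valuation m) : Prop :=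
  IsXOS v ∧ HasBinaryMarginals v

/-- The values of the bundles that a budget `b` can buy at the prices `p`. -/
def affordableValues {m : ℕ} (v : Valuation m) (b : ℝ) (p : Fin m → ℝ) : Set ℝ :=
  v '' {S : Finset (Fin m) | ∑ g ∈ S, p g ≤ b}

/-- The AnyPrice share of an agent with valuation `v` among `n` equally entitled agents:
`min_p max {v S | p(S) ≤ 1/n}`, over the nonnegative price vectors `p` of total price `1`.
Since `v` has finitely many values, the minimum exists whenever there is a good; without goods
there is no price vector, and the infimum of the empty set is `0`, the value of having nothing. -/
def APS {m : ℕ} (n : ℕ) (v : Valuation m) : ℝ :=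
  sInf {z : ℝ | ∃ p ∈ stdSimplex ℝ (Fin m), IsGreatest (affordableValues v (1 / (n : ℝ)) p) z}

/-- An allocation of the goods `[m]` to the agents `[n]`, given by the owner of each good. -/
abbrev Allocation (n m : ℕ) : Type := Fin m → Fin n

/-- The bundle of agent `i`. -/
def bundle {n m : ℕ} (A : Allocation n m) (i : Fin n) : Finset (Fin m) :=
  Finset.univ.filter fun g => A g = i

/-- `A` is an `α`-APS allocation: every agent values their bundle at least `α` times their APS. -/
def IsAPSAllocation {n m : ℕ} (α : ℝ) (v : Fin n → Valuation m) (A : Allocation n m) : Prop :=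
  ∀ i : Fin n, α * APS n (v i) ≤ v i (bundle A i)

/-! ### Random access machines with a value oracle

A program is a fixed finite object that works for all instances. The memory consists of cells
`0, 1, 2, …` that hold natural numbers. There is no multiplication, so the bit length of the
numbers grows by at most one per step, and unit costs agree with Turing machine time up to
polynomials. -/

/-- Programs. Below, `M[x]` is the content of cell `x`. -/
inductive Program : Type
  /-- Do nothing. -/
  | skip : Program
  /-- `M[x] := k` -/
  | const (x k : ℕ) : Program
  /-- `M[x] := M[y] + M[z]` -/
  | add (x y z : ℕ) : Program
  /-- `M[x] := max (M[y] - M[z]) 0` -/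
  | sub (x y z : ℕ) : Program
  /-- `M[x] := M[M[y]]` -/
  | load (x y : ℕ) : Program
  /-- `M[M[x]] := M[y]` -/
  | store (x y : ℕ) : Program
  /-- Ask the oracle for the value that agent number `M[a]` has for the set of those goods `g < m`
  that have `M[M[s] + g] ≠ 0`, and put the answer into cell `x`. -/
  | query (x a s : ℕ) : Program
  /-- First `c`, then `d`. -/
  | seq (c d : Program) : Program
  /-- If `M[x] ≠ 0` then `c` else `d`. -/
  | branch (x : ℕ) (c d : Program) : Program
  /-- While `M[x] ≠ 0` do `c`. -/
  | loop (x : ℕ) (c : Program) : Program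

/-- The contents of the memory. -/
abbrev Memory : Type := ℕ → ℕ

/-- The set of goods whose indicator vector is stored in the `m` cells from `s` on. -/
def storedSet (m : ℕ) (M : Memory) (s : ℕ) : Finset (Fin m) :=
  Finset.univ.filter fun g => M (s + (g : ℕ)) ≠ 0

/-- `Runs v c M t M'`: with the valuations `v` as oracle, program `c` started on memory `M` halts
after time `t` with memory `M'`. Each basic step and each test costs `1`, and a query costs `1`
plus the length `m` of the queried indicator vector. A query whose agent does not exist, or whose
answer is not a natural number, has no rule: the program is stuck and does not halt. (The values
of a function with binary marginals and `v ∅ = 0` are natural numbers.) -/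
inductive Runs {n m : ℕ} (v : Fin n → Valuation m) :
    Program → Memory → ℕ → Memory → Prop
  | skip (M : Memory) : Runs v .skip M 1 M
  | const (M : Memory) (x k : ℕ) : Runs v (.const x k) M 1 (Function.update M x k)
  | add (M : Memory) (x y z : ℕ) : Runs v (.add x y z) M 1 (Function.update M x (M y + M z))
  | sub (M : Memory) (x y z : ℕ) : Runs v (.sub x y z) M 1 (Function.update M x (M y - M z))
  | load (M : Memory) (x y : ℕ) : Runs v (.load x y) M 1 (Function.update M x (M (M y)))
  | store (M : Memory) (x y : ℕ) : Runs v (.store x y) M 1 (Function.update M (M x) (M y))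
  | query (M : Memory) (x a s : ℕ) (i : Fin n) (k : ℕ) (hi : (i : ℕ) = M a)
      (hk : v i (storedSet m M (M s)) = (k : ℝ)) :
      Runs v (.query x a s) M (m + 1) (Function.update M x k)
  | seq {c d : Program} {M M₁ M₂ : Memory} {t₁ t₂ : ℕ}
      (h₁ : Runs v c M t₁ M₁) (h₂ : Runs v d M₁ t₂ M₂) :
      Runs v (.seq c d) M (t₁ + t₂) M₂
  | branch_true {c d : Program} {M M₁ : Memory} {t x : ℕ} (hx : M x ≠ 0)
      (h : Runs v c M t M₁) : Runs v (.branch x c d) M (t + 1) M₁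
  | branch_false {c d : Program} {M M₁ : Memory} {t x : ℕ} (hx : M x = 0)
      (h : Runs v d M t M₁) : Runs v (.branch x c d) M (t + 1) M₁
  | loop_true {c : Program} {M M₁ M₂ : Memory} {t₁ t₂ x : ℕ} (hx : M x ≠ 0)
      (h₁ : Runs v c M t₁ M₁) (h₂ : Runs v (.loop x c) M₁ t₂ M₂) :
      Runs v (.loop x c) M (t₁ + t₂ + 1) M₂
  | loop_false {c : Program} {M : Memory} {x : ℕ} (hx : M x = 0) :
      Runs v (.loop x c) M 1 M

/-- Programs are deterministic: there is at most one halting run, so that it is legitimate to speak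
of the running time and of the result. -/
theorem Runs.deterministic {n m : ℕ} {v : Fin n → Valuation m} {c : Program} {M M₁ M₂ : Memory}
    {t₁ t₂ : ℕ} (h₁ : Runs v c M t₁ M₁) (h₂ : Runs v c M t₂ M₂) : t₁ = t₂ ∧ M₁ = M₂ := by
  induction h₁ generalizing t₂ M₂ with
  | skip | const | add | sub | load | store => cases h₂; exact ⟨rfl, rfl⟩
  | query M x a s i k hi hk =>
    cases h₂ with
    | query _ _ _ _ j l hj hl =>
      obtain rfl : i = j := Fin.ext (hi.trans hj.symm)
      obtain rfl : k = l := by exact_mod_cast hk.symm.trans hl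
      exact ⟨rfl, rfl⟩
  | seq _ _ ih ih' =>
    cases h₂ with
    | seq k k' =>
      obtain ⟨rfl, rfl⟩ := ih k
      obtain ⟨rfl, rfl⟩ := ih' k'
      exact ⟨rfl, rfl⟩
  | branch_true hx _ ih =>
    cases h₂ with
    | branch_true _ k => obtain ⟨rfl, rfl⟩ := ih k; exact ⟨rfl, rfl⟩
    | branch_false hx' _ => exact absurd hx' hx
  | branch_false hx _ ih =>
    cases h₂ with
    | branch_true hx' _ => exact absurd hx hx'
    | branch_false _ k => obtain ⟨rfl, rfl⟩ := ih k; exact ⟨rfl, rfl⟩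
  | loop_true hx _ _ ih ih' =>
    cases h₂ with
    | loop_true _ k k' =>
      obtain ⟨rfl, rfl⟩ := ih k
      obtain ⟨rfl, rfl⟩ := ih' k'
      exact ⟨rfl, rfl⟩
    | loop_false hx' => exact absurd hx' hx
  | loop_false hx =>
    cases h₂ with
    | loop_true hx' _ _ => exact absurd hx hx'
    | loop_false _ => exact ⟨rfl, rfl⟩

/-- The initial memory: `n` in cell `0`, `m` in cell `1`, and `0` in all other cells. -/
def inputMemory (n m : ℕ) : Memory := fun x => if x = 0 then n else if x = 1 then m else 0

/-- With the valuations `v` as oracle, program `c` halts within time `T` and outputs the allocation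
`A`: in the end, cell `g` holds the number of the owner of good `g`, for each good `g`. -/
def ComputesWithin {n m : ℕ} (c : Program) (v : Fin n → Valuation m) (T : ℕ)
    (A : Allocation n m) : Prop :=
  ∃ (t : ℕ) (M : Memory), Runs v c (inputMemory n m) t M ∧ t ≤ T ∧
    ∀ g : Fin m, M (g : ℕ) = (A g : ℕ)

end

end FairDivision

namespace FairDivision

/-! ### Binary XOS valuations and upper bounds on the AnyPrice share -/

/-! The algorithm attains the factor `1/2`, which the second part shows to be optimal; `0.1222`
follows because the share is nonnegative.

Every agent has an integer target, initially `m`. A pass treats the agents in order of increasing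
target. An agent with target `ℓ` takes an inclusion-minimal set of remaining goods of value at least
`ℓ`. If the remaining goods `R` are worth less than `ℓ` to the agent, the target drops to `ℓ - 1`
and, after the current pass, another one is made from scratch. The loop ends with a pass in which
nobody fails; since targets only decrease, there are polynomially many passes.

Two facts make the targets stay at least half the shares. Minimal sets are small: if every good of
`X` is critical for `ℓ`, then an additive function supporting `X` gives every good weight at least
`1`, so `X` has at most `ℓ` goods (`IsUnitXOS.card_le`). Hence, when an agent fails at `ℓ`, at most
`n - 1` others have taken at most `ℓ` goods each. Pricing the taken goods uniformly and `R` at zero,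
a budget of `1/n` buys fewer than `ℓ` taken goods, which together with `R` are worth at most `2 * (ℓ
- 1)`. So the share is at most twice the lowered target (`APS_le_add`, `PassInvariant.fail`).

The remainder implements this on the machine, by Hoare-style reasoning with time bounds (`Wp`). For
the impossibility, six goods form two disjoint triangles and a set is worth the largest part of an
edge that it contains. -/

/-- The combinatorial content of binary XOS: natural-valued, monotone, unit marginals, and sets
all of whose goods are critical for the value `ℓ` have at most `ℓ` goods. -/
structure IsUnitXOS {m : ℕ} (w : Finset (Fin m) → ℕ) : Prop where
  empty : w ∅ = 0
  mono : Monotone w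
  insert_le : ∀ S g, w (insert g S) ≤ w S + 1
  card_le : ∀ (X : Finset (Fin m)) (ℓ : ℕ), ℓ ≤ w X → (∀ g ∈ X, w (X.erase g) < ℓ) → X.card ≤ ℓ

theorem IsBinaryXOS.exists_nat {m : ℕ} {v : Valuation m} (hv : IsBinaryXOS v) :
    ∃ w : Finset (Fin m) → ℕ, (∀ S, v S = w S) ∧ IsUnitXOS w := by
  obtain ⟨⟨F, hF, hmax⟩, hbin⟩ := hv
  have h0 : v ∅ = 0 := by
    obtain ⟨f, -, hf⟩ := (hmax ∅).1
    simpa using hf.symm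
  have hnat : ∀ S, ∃ k : ℕ, v S = k := by
    intro S
    induction S using Finset.induction_on with
    | empty => exact ⟨0, by simpa using h0⟩
    | insert g S hg ih =>
      obtain ⟨k, hk⟩ := ih
      rcases hbin S g hg with h | h
      · exact ⟨k, by linarith⟩
      · exact ⟨k + 1, by push_cast; linarith⟩
  choose w hw using hnat
  have hins : ∀ S g, w S ≤ w (insert g S) ∧ w (insert g S) ≤ w S + 1 := by
    intro S g
    by_cases hg : g ∈ S
    · simp [Finset.insert_eq_of_mem hg]
    · have := hbin S g hg
      rw [hw, hw] at this
      constructor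
      · have : (w S : ℝ) ≤ w (insert g S) := by rcases this with h | h <;> linarith
        exact_mod_cast this
      · have : (w (insert g S) : ℝ) ≤ w S + 1 := by rcases this with h | h <;> linarith
        exact_mod_cast this
  refine ⟨w, hw, ?_, ?_, fun S g => (hins S g).2, ?_⟩
  · have := hw ∅
    rw [h0] at this
    exact_mod_cast this.symm
  · intro S T hST
    induction T using Finset.induction_on generalizing S with
    | empty => rw [Finset.subset_empty.1 hST]
    | insert g T hg ih =>
      -- If `g ∈ S`, then `S` need not lie in `T` and the induction hypothesis does not apply; an
      -- additive function supporting `S` gives the inequality directly.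
      by_cases hgS : g ∈ S
      · obtain ⟨f, hfF, hf⟩ := (hmax S).1
        have h2 := (hmax (insert g T)).2 ⟨f, hfF, rfl⟩
        have h3 : ∑ x ∈ S, f x ≤ ∑ x ∈ insert g T, f x :=
          Finset.sum_le_sum_of_subset_of_nonneg hST fun x _ _ => hF f hfF x
        simp only at hf h2
        rw [hw] at hf h2
        have : (w S : ℝ) ≤ w (insert g T) := by linarith
        exact_mod_cast this
      · exact (ih ((Finset.subset_insert_iff_of_notMem hgS).1 hST)).trans (hins T g).1
  · intro X ℓ hX hcrit
    rcases X.eq_empty_or_nonempty with rfl | ⟨g₀, hg₀⟩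
    · simp
    have hval : w X ≤ ℓ := by
      have h1 := (hins (X.erase g₀) g₀).2
      rw [Finset.insert_erase hg₀] at h1
      have := hcrit g₀ hg₀
      omega
    obtain ⟨f, hfF, hf⟩ := (hmax X).1
    simp only at hf
    rw [hw] at hf
    -- The function `f` supporting `X` is also a lower bound for the value of `X.erase g`, so the
    -- loss of at least one unit must be covered by `f g`.
    have h1 : ∀ g ∈ X, (1 : ℝ) ≤ f g := by
      intro g hg
      have h2 := (hmax (X.erase g)).2 ⟨f, hfF, rfl⟩
      simp only at h2
      rw [hw, Finset.sum_erase_eq_sub hg, hf] at h2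
      have h3 : (w (X.erase g) : ℝ) + 1 ≤ w X := by
        exact_mod_cast (Nat.succ_le_of_lt (hcrit g hg)).trans hX
      linarith
    have h4 : (X.card : ℝ) ≤ w X := by
      rw [← hf]
      simpa using Finset.card_nsmul_le_sum X f 1 h1
    have h5 : X.card ≤ w X := by exact_mod_cast h4
    omega

theorem IsUnitXOS.union_le {m : ℕ} {w : Finset (Fin m) → ℕ} (h : IsUnitXOS w)
    (S T : Finset (Fin m)) : w (S ∪ T) ≤ w S + T.card := by
  induction T using Finset.induction_on with
  | empty => simp
  | insert g T hg ih =>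
    rw [Finset.union_insert, Finset.card_insert_of_notMem hg]
    have := h.insert_le (S ∪ T) g
    omega

theorem exists_isGreatest_affordableValues {m : ℕ} (v : Valuation m) {b : ℝ} (hb : 0 ≤ b)
    (p : Fin m → ℝ) : ∃ z, IsGreatest (affordableValues v b p) z := by
  have hfin : (affordableValues v b p).Finite := (Set.toFinite _).image v
  obtain ⟨z, hz⟩ := hfin.exists_maximal ⟨v ∅, ∅, by simpa using hb, rfl⟩
  exact ⟨z, hz.prop, fun y hy => le_of_not_gt fun hlt => hz.not_prop_of_gt hlt hy⟩

/-- Any price vector bounds the AnyPrice share. -/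
theorem APS_le {m n : ℕ} {v : Valuation m} {w : Finset (Fin m) → ℕ} (hw : ∀ S, v S = w S)
    {p : Fin m → ℝ} (hp : p ∈ stdSimplex ℝ (Fin m)) {b : ℕ}
    (hb : ∀ S : Finset (Fin m), ∑ g ∈ S, p g ≤ 1 / (n : ℝ) → w S ≤ b) : APS n v ≤ b := by
  obtain ⟨z, hz'⟩ := exists_isGreatest_affordableValues v (b := 1 / (n : ℝ)) (by positivity) p
  have hle : z ≤ b := by
    obtain ⟨S, hS, rfl⟩ := hz'.1
    rw [hw]
    exact_mod_cast hb S hS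
  refine le_trans (csInf_le ⟨0, ?_⟩ ⟨p, hp, hz'⟩) hle
  rintro y ⟨q, -, hy⟩
  obtain ⟨S, -, rfl⟩ := hy.1
  rw [hw]
  positivity

/-- Makes the initial targets `m` valid. Without goods the simplex is empty and the share is `sInf ∅
= 0`. -/
theorem APS_le_card {m n : ℕ} {v : Valuation m} {w : Finset (Fin m) → ℕ} (hw : ∀ S, v S = w S)
    (h : IsUnitXOS w) : APS n v ≤ m := by
  rcases Nat.eq_zero_or_pos m with rfl | hm
  · have : APS n v = 0 := by
      unfold APS
      convert Real.sInf_empty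
      ext z
      simp only [Set.mem_ofPred_eq, Set.mem_empty_iff_false, iff_false, not_exists, not_and]
      intro p hp
      simpa using hp.2
    simp [this]
  · refine APS_le hw (single_mem_stdSimplex ℝ (⟨0, hm⟩ : Fin m)) fun S _ => ?_
    have := h.union_le ∅ S
    rw [Finset.empty_union, h.empty] at this
    have h2 := S.card_le_univ
    rw [Fintype.card_fin] at h2
    omega

/-- Uniform prices on the goods outside `R`. -/
theorem APS_le_add {m n ℓ : ℕ} {v : Valuation m} {w : Finset (Fin m) → ℕ}
    (hw : ∀ S, v S = w S) (h : IsUnitXOS w) (hn : 0 < n) (R : Finset (Fin m))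
    (hR : Rᶜ.card ≤ (n - 1) * ℓ) (hℓ : w R < ℓ) : APS n v + 2 ≤ 2 * ℓ := by
  have hsplit : ∀ S : Finset (Fin m), w S ≤ w R + (S ∩ Rᶜ).card := by
    intro S
    refine (h.mono ?_).trans (h.union_le R (S ∩ Rᶜ))
    intro g hg
    by_cases hgR : g ∈ R <;> simp [hg, hgR]
  have key : APS n v ≤ (w R + (ℓ - 1) : ℕ) := by
    -- If nothing lies outside `R`, uniform prices do not exist, but then any prices do, because no
    -- set is worth more than `R`.
    rcases Rᶜ.eq_empty_or_nonempty with hZ | hZ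
    · rcases Nat.eq_zero_or_pos m with rfl | hm
      · exact (APS_le_card hw h).trans (by push_cast; positivity)
      · refine APS_le hw (single_mem_stdSimplex ℝ (⟨0, hm⟩ : Fin m)) fun S _ => ?_
        have := hsplit S
        rw [hZ] at this
        simp at this
        omega
    · have hc : 0 < (Rᶜ.card : ℝ) := by exact_mod_cast hZ.card_pos
      have hsum : ∀ S : Finset (Fin m),
          ∑ g ∈ S, (if g ∈ Rᶜ then (1 / (Rᶜ.card : ℝ)) else 0) = (S ∩ Rᶜ).card / Rᶜ.card := by
        intro S
        rw [← Finset.sum_filter, Finset.filter_mem_eq_inter, Finset.sum_const, nsmul_eq_mul]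
        ring
      refine APS_le hw (p := fun g => if g ∈ Rᶜ then (1 / (Rᶜ.card : ℝ)) else 0) ⟨?_, ?_⟩ ?_
      · intro g
        dsimp only
        split_ifs <;> positivity
      · rw [hsum, Finset.univ_inter, div_self hc.ne']
      · intro S hS
        rw [hsum, div_le_div_iff₀ hc (by exact_mod_cast hn), one_mul] at hS
        have h1 : (S ∩ Rᶜ).card * n ≤ Rᶜ.card := by exact_mod_cast hS
        -- The gap between `n - 1` and `n` makes this strict, which saves the unit that lets the
        -- target drop.
        have h2 : (S ∩ Rᶜ).card * n < ℓ * n := by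
          refine h1.trans_lt (hR.trans_lt ?_)
          rw [mul_comm ℓ n]
          exact Nat.mul_lt_mul_of_pos_right (by omega) (by omega)
        have h3 := Nat.lt_of_mul_lt_mul_right h2
        have := hsplit S
        omega
  have h5 : ((w R + (ℓ - 1) : ℕ) : ℝ) + 2 ≤ 2 * ℓ := by
    have : w R + (ℓ - 1) + 2 ≤ 2 * ℓ := by omega
    exact_mod_cast this
  linarith

/-! ### Two triangles -/

/-- The edges of two disjoint triangles on six goods, as pairs. -/
def triangleEdge : Fin 6 → Finset (Fin 6) :=
  ![{0, 1}, {1, 2}, {0, 2}, {3, 4}, {4, 5}, {3, 5}]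

/-- The largest number of goods of an edge that a set contains. -/
def triangleRank (S : Finset (Fin 6)) : ℕ :=
  Finset.univ.sup fun e => (S ∩ triangleEdge e).card

theorem triangleRank_isBinaryXOS : IsBinaryXOS fun S => (triangleRank S : ℝ) := by
  constructor
  · refine ⟨Set.range fun e g => if g ∈ triangleEdge e then 1 else 0, ?_, ?_⟩
    · rintro _ ⟨e, rfl⟩ g
      dsimp only
      split_ifs <;> norm_num
    · intro S
      have hsum : ∀ e, ∑ g ∈ S, (if g ∈ triangleEdge e then (1 : ℝ) else 0)
          = (S ∩ triangleEdge e).card := by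
        intro e
        rw [← Finset.sum_filter, Finset.filter_mem_eq_inter]
        simp
      constructor
      · obtain ⟨e, -, he⟩ := Finset.exists_mem_eq_sup Finset.univ Finset.univ_nonempty
          fun e => (S ∩ triangleEdge e).card
        exact ⟨_, ⟨e, rfl⟩, by simp only [hsum]; unfold triangleRank; rw [he]⟩
      · rintro _ ⟨_, ⟨e, rfl⟩, rfl⟩
        simp only [hsum]
        exact_mod_cast Finset.le_sup (f := fun e => (S ∩ triangleEdge e).card)
          (Finset.mem_univ e)
  · intro S g hg
    have h : triangleRank (insert g S) = triangleRank S ∨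
        triangleRank (insert g S) = triangleRank S + 1 := by
      revert S g
      decide +kernel
    rcases h with h | h <;> simp [h]

/-- Every good lies on two edges, so the six edge prices add up to `2` and some edge costs at most
`1/3`. -/
theorem two_le_APS_triangleRank : 2 ≤ APS 3 fun S => (triangleRank S : ℝ) := by
  have hbd : ∀ p ∈ stdSimplex ℝ (Fin 6), ∃ e, ∑ g ∈ triangleEdge e, p g ≤ 1 / (3 : ℕ) := by
    intro p hp
    by_contra! hcon
    have hs := hp.2
    have h0 := hcon 0
    have h1 := hcon 1
    have h2 := hcon 2
    have h3 := hcon 3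
    have h4 := hcon 4
    have h5 := hcon 5
    simp [triangleEdge, Fin.sum_univ_six] at hs h0 h1 h2 h3 h4 h5
    linarith
  have hrank : ∀ e, triangleRank (triangleEdge e) = 2 := by decide
  refine le_csInf ?_ ?_
  · obtain ⟨z, hz⟩ := exists_isGreatest_affordableValues (fun S => (triangleRank S : ℝ))
      (b := 1 / ((3 : ℕ) : ℝ)) (by positivity) (Pi.single 0 1)
    exact ⟨z, _, single_mem_stdSimplex ℝ 0, hz⟩
  · rintro z ⟨p, hp, hz⟩
    obtain ⟨e, he⟩ := hbd p hp
    have := hz.2 ⟨_, he, rfl⟩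
    simpa [hrank] using this

/-- A bundle of value `2` contains an edge, and two edges of one triangle meet. So at most two
disjoint bundles have value `2`. The kernel checks all allocations. -/
theorem exists_triangleRank_bundle_le_one (A : Allocation 3 6) :
    ∃ i, triangleRank (bundle A i) ≤ 1 := by
  revert A
  decide +kernel

theorem triangleRank_not_isAPSAllocation {α : ℝ} (hα : 1 / 2 < α) (A : Allocation 3 6) :
    ¬ IsAPSAllocation α (fun _ : Fin 3 => fun S => (triangleRank S : ℝ)) A := by
  intro h
  obtain ⟨i, hi⟩ := exists_triangleRank_bundle_le_one A
  have h1 := h i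
  have h2 := two_le_APS_triangleRank
  have h3 : (triangleRank (bundle A i) : ℝ) ≤ 1 := by exact_mod_cast hi
  simp only at h1
  nlinarith

/-! ### Weakest preconditions -/

section Wp

variable {n m : ℕ} {v : Fin n → Valuation m}

/-- From memory `M`, program `c` halts with a running time and a memory that satisfy `Q`. -/
def Wp (v : Fin n → Valuation m) (c : Program) (M : Memory) (Q : ℕ → Memory → Prop) : Prop :=
  ∃ t M', Runs v c M t M' ∧ Q t M'

theorem Wp.imp {c : Program} {M : Memory} {Q Q' : ℕ → Memory → Prop} (h : Wp v c M Q)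
    (hQ : ∀ t M', Q t M' → Q' t M') : Wp v c M Q' := by
  obtain ⟨t, M', h, hq⟩ := h
  exact ⟨t, M', h, hQ _ _ hq⟩

theorem wp_skip {M : Memory} {Q : ℕ → Memory → Prop} (h : Q 1 M) : Wp v .skip M Q :=
  ⟨_, _, .skip M, h⟩

theorem wp_const {M : Memory} {Q : ℕ → Memory → Prop} {x k : ℕ}
    (h : Q 1 (Function.update M x k)) : Wp v (.const x k) M Q :=
  ⟨_, _, .const M x k, h⟩

theorem wp_add {M : Memory} {Q : ℕ → Memory → Prop} {x y z : ℕ}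
    (h : Q 1 (Function.update M x (M y + M z))) : Wp v (.add x y z) M Q :=
  ⟨_, _, .add M x y z, h⟩

theorem wp_sub {M : Memory} {Q : ℕ → Memory → Prop} {x y z : ℕ}
    (h : Q 1 (Function.update M x (M y - M z))) : Wp v (.sub x y z) M Q :=
  ⟨_, _, .sub M x y z, h⟩

theorem wp_load {M : Memory} {Q : ℕ → Memory → Prop} {x y : ℕ}
    (h : Q 1 (Function.update M x (M (M y)))) : Wp v (.load x y) M Q :=
  ⟨_, _, .load M x y, h⟩

theorem wp_store {M : Memory} {Q : ℕ → Memory → Prop} {x y a : ℕ} (ha : M x = a)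
    (h : Q 1 (Function.update M a (M y))) : Wp v (.store x y) M Q :=
  ⟨_, _, .store M x y, ha ▸ h⟩

theorem wp_query {w : Fin n → Finset (Fin m) → ℕ} (hw : ∀ i S, v i S = w i S) {M : Memory}
    {Q : ℕ → Memory → Prop} {x a s : ℕ} {i : Fin n} {S : Finset (Fin m)} (hi : M a = i)
    (hS : storedSet m M (M s) = S) (h : Q (m + 1) (Function.update M x (w i S))) :
    Wp v (.query x a s) M Q :=
  ⟨_, _, .query M x a s i (w i S) hi.symm (by rw [hS, hw]), h⟩

theorem wp_seq {c d : Program} {M : Memory} {Q : ℕ → Memory → Prop}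
    (h : Wp v c M fun t M' => Wp v d M' fun t' M'' => Q (t + t') M'') :
    Wp v (.seq c d) M Q := by
  obtain ⟨t, M', h, t', M'', h', hq⟩ := h
  exact ⟨_, _, .seq h h', hq⟩

theorem wp_branch {c d : Program} {M : Memory} {Q : ℕ → Memory → Prop} {x : ℕ}
    (h1 : M x ≠ 0 → Wp v c M fun t M' => Q (t + 1) M')
    (h2 : M x = 0 → Wp v d M fun t M' => Q (t + 1) M') : Wp v (.branch x c d) M Q := by
  by_cases hx : M x = 0
  · obtain ⟨t, M', h, hq⟩ := h2 hx
    exact ⟨_, _, .branch_false hx h, hq⟩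
  · obtain ⟨t, M', h, hq⟩ := h1 hx
    exact ⟨_, _, .branch_true hx h, hq⟩

/-- Loops with a variant. -/
theorem wp_loop {x T : ℕ} {c : Program} (I : ℕ → Memory → Prop)
    (step : ∀ k M, I k M → M x ≠ 0 → Wp v c M fun t M' => t ≤ T ∧ ∃ k' < k, I k' M') :
    ∀ k M, I k M →
      Wp v (.loop x c) M fun t M' => t ≤ k * (T + 1) + 1 ∧ M' x = 0 ∧ ∃ k', I k' M' := by
  intro k
  induction k using Nat.strong_induction_on with
  | _ k ih =>
    intro M hM
    by_cases hx : M x = 0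
    · exact ⟨1, M, .loop_false hx, by omega, hx, k, hM⟩
    · obtain ⟨t, M', hr, ht, k', hk', hM'⟩ := step k M hM hx
      obtain ⟨t', M'', hr', ht', h0, hI⟩ := ih k' hk' M' hM'
      refine ⟨_, _, .loop_true hx hr hr', ?_, h0, hI⟩
      -- The variant may drop by more than one; naming the slack makes the time bound linear in the
      -- products.
      obtain ⟨j, rfl⟩ : ∃ j, k = k' + 1 + j := ⟨k - (k' + 1), by omega⟩
      have : (k' + 1 + j) * (T + 1) = k' * (T + 1) + (T + 1) + j * (T + 1) := by ring
      have := Nat.zero_le (j * (T + 1))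
      omega

/-- Loops whose control cell counts down. -/
theorem wp_countdown {x T : ℕ} {c : Program} (I : ℕ → Memory → Prop)
    (hx : ∀ k M, I k M → M x = k)
    (step : ∀ k M, I (k + 1) M → Wp v c M fun t M' => t ≤ T ∧ I k M') (k : ℕ) (M : Memory)
    (h : I k M) : Wp v (.loop x c) M fun t M' => t ≤ k * (T + 1) + 1 ∧ I 0 M' := by
  refine (wp_loop (v := v) (T := T) I ?_ k M h).imp ?_
  · intro k M hM h0
    rw [hx k M hM] at h0
    obtain ⟨k, rfl⟩ := Nat.exists_eq_succ_of_ne_zero h0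
    exact (step k M hM).imp fun t M' ⟨ht, hI⟩ => ⟨ht, k, by omega, hI⟩
  · rintro t M' ⟨ht, h0, k', hk'⟩
    rw [hx k' M' hk'] at h0
    exact ⟨ht, h0 ▸ hk'⟩

end Wp

/-! ### Memory layout -/

/-- The contents of the data structures: `d i` is `m + 1` minus the target of agent `i`, `R` holds
the remaining goods, `X` is a scratch set, and `o` holds the owners. -/
structure State (n m : ℕ) where
  d : Fin n → ℕ
  R : Finset (Fin m)
  X : Finset (Fin m)
  o : Fin m → Fin n
  flag : ℕ
  lvl : ℕ
  agt : ℕ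
  good : ℕ
  thr : ℕ

/-- Memory `M` represents state `s`. Cells `12`, `13` and `15` are free for temporary values, and so
are the cells from `16` to `m + 15`. -/
structure Repr {n m : ℕ} (M : Memory) (s : State n m) : Prop where
  num_agents : M 0 = n
  num_goods : M 1 = m
  one : M 2 = 1
  base_o : M 3 = 16 + m
  base_X : M 4 = 16 + 2 * m
  base_R : M 5 = 16 + 3 * m
  base_d : M 6 = 16 + 4 * m
  flag : M 7 = s.flag
  lvl : M 8 = s.lvl
  agt : M 9 = s.agt
  good : M 10 = s.good
  thr : M 14 = s.thr
  o : ∀ g : Fin m, M (16 + m + g) = s.o g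
  X : ∀ g : Fin m, M (16 + 2 * m + g) = if g ∈ s.X then 1 else 0
  R : ∀ g : Fin m, M (16 + 3 * m + g) = if g ∈ s.R then 1 else 0
  d : ∀ i : Fin n, M (16 + 4 * m + i) = s.d i

namespace Repr

variable {n m : ℕ} {M : Memory} {s : State n m}

theorem storedSet_X (h : Repr M s) : storedSet m M (16 + 2 * m) = s.X := by
  ext g
  simp [storedSet, h.X]

theorem storedSet_R (h : Repr M s) : storedSet m M (16 + 3 * m) = s.R := by
  ext g
  simp [storedSet, h.R]

theorem update_temp (h : Repr M s) {x : ℕ} (hx : x = 12 ∨ x = 13 ∨ x = 15) (k : ℕ) :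
    Repr (Function.update M x k) s := by
  have key : ∀ y, y ≠ x → Function.update M x k y = M y := fun y hy =>
    Function.update_of_ne hy _ _
  constructor <;> intros <;> rw [key _ (by omega)]
  exacts [h.num_agents, h.num_goods, h.one, h.base_o, h.base_X, h.base_R, h.base_d, h.flag, h.lvl,
    h.agt, h.good, h.thr, h.o _, h.X _, h.R _, h.d _]

theorem update_flag (h : Repr M s) (k : ℕ) :
    Repr (Function.update M 7 k) { s with flag := k } := by
  have key : ∀ y, y ≠ 7 → Function.update M 7 k y = M y := fun y hy =>
    Function.update_of_ne hy _ _
  constructor <;> intros <;> first | rw [Function.update_self] | rw [key _ (by omega)]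
  exacts [h.num_agents, h.num_goods, h.one, h.base_o, h.base_X, h.base_R, h.base_d, h.lvl,
    h.agt, h.good, h.thr, h.o _, h.X _, h.R _, h.d _]

theorem update_lvl (h : Repr M s) (k : ℕ) :
    Repr (Function.update M 8 k) { s with lvl := k } := by
  have key : ∀ y, y ≠ 8 → Function.update M 8 k y = M y := fun y hy =>
    Function.update_of_ne hy _ _
  constructor <;> intros <;> first | rw [Function.update_self] | rw [key _ (by omega)]
  exacts [h.num_agents, h.num_goods, h.one, h.base_o, h.base_X, h.base_R, h.base_d, h.flag,
    h.agt, h.good, h.thr, h.o _, h.X _, h.R _, h.d _]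

theorem update_agt (h : Repr M s) (k : ℕ) :
    Repr (Function.update M 9 k) { s with agt := k } := by
  have key : ∀ y, y ≠ 9 → Function.update M 9 k y = M y := fun y hy =>
    Function.update_of_ne hy _ _
  constructor <;> intros <;> first | rw [Function.update_self] | rw [key _ (by omega)]
  exacts [h.num_agents, h.num_goods, h.one, h.base_o, h.base_X, h.base_R, h.base_d, h.flag, h.lvl,
    h.good, h.thr, h.o _, h.X _, h.R _, h.d _]

theorem update_good (h : Repr M s) (k : ℕ) :
    Repr (Function.update M 10 k) { s with good := k } := by
  have key : ∀ y, y ≠ 10 → Function.update M 10 k y = M y := fun y hy =>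
    Function.update_of_ne hy _ _
  constructor <;> intros <;> first | rw [Function.update_self] | rw [key _ (by omega)]
  exacts [h.num_agents, h.num_goods, h.one, h.base_o, h.base_X, h.base_R, h.base_d, h.flag, h.lvl,
    h.agt, h.thr, h.o _, h.X _, h.R _, h.d _]

theorem update_thr (h : Repr M s) (k : ℕ) :
    Repr (Function.update M 14 k) { s with thr := k } := by
  have key : ∀ y, y ≠ 14 → Function.update M 14 k y = M y := fun y hy =>
    Function.update_of_ne hy _ _
  constructor <;> intros <;> first | rw [Function.update_self] | rw [key _ (by omega)]
  exacts [h.num_agents, h.num_goods, h.one, h.base_o, h.base_X, h.base_R, h.base_d, h.flag, h.lvl,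
    h.agt, h.good, h.o _, h.X _, h.R _, h.d _]

theorem update_o (h : Repr M s) (g : Fin m) (i : Fin n) :
    Repr (Function.update M (16 + m + g) i) { s with o := Function.update s.o g i } := by
  have key : ∀ y, y ≠ 16 + m + g → Function.update M (16 + m + g) i y = M y := fun y hy =>
    Function.update_of_ne hy _ _
  refine ⟨?_, ?_, ?_, ?_, ?_, ?_, ?_, ?_, ?_, ?_, ?_, ?_, fun g' => ?_, ?_, ?_, ?_⟩
  case refine_13 =>
    by_cases hg : g' = g
    · subst hg; simp
    · rw [key _ (by have := Fin.val_ne_of_ne hg; omega), h.o]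
      simp [Function.update_of_ne hg]
  all_goals intros; rw [key _ (by omega)]
  exacts [h.num_agents, h.num_goods, h.one, h.base_o, h.base_X, h.base_R, h.base_d, h.flag, h.lvl,
    h.agt, h.good, h.thr, h.X _, h.R _, h.d _]

theorem update_d (h : Repr M s) (i : Fin n) (k : ℕ) :
    Repr (Function.update M (16 + 4 * m + i) k) { s with d := Function.update s.d i k } := by
  have key : ∀ y, y ≠ 16 + 4 * m + i → Function.update M (16 + 4 * m + i) k y = M y :=
    fun y hy => Function.update_of_ne hy _ _
  refine ⟨?_, ?_, ?_, ?_, ?_, ?_, ?_, ?_, ?_, ?_, ?_, ?_, ?_, ?_, ?_, fun j => ?_⟩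
  case refine_16 =>
    by_cases hg : j = i
    · subst hg; simp
    · rw [key _ (by have := Fin.val_ne_of_ne hg; omega), h.d]
      simp [Function.update_of_ne hg]
  all_goals intros; rw [key _ (by omega)]
  exacts [h.num_agents, h.num_goods, h.one, h.base_o, h.base_X, h.base_R, h.base_d, h.flag, h.lvl,
    h.agt, h.good, h.thr, h.o _, h.X _, h.R _]

theorem update_X (h : Repr M s) (g : Fin m) (k : ℕ) (X : Finset (Fin m))
    (hk : k = if g ∈ X then 1 else 0) (hX : ∀ g', g' ≠ g → (g' ∈ X ↔ g' ∈ s.X)) :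
    Repr (Function.update M (16 + 2 * m + g) k) { s with X := X } := by
  have key : ∀ y, y ≠ 16 + 2 * m + g → Function.update M (16 + 2 * m + g) k y = M y :=
    fun y hy => Function.update_of_ne hy _ _
  refine ⟨?_, ?_, ?_, ?_, ?_, ?_, ?_, ?_, ?_, ?_, ?_, ?_, ?_, fun g' => ?_, ?_, ?_⟩
  case refine_14 =>
    by_cases hg : g' = g
    · subst hg; simp [hk]
    · rw [key _ (by have := Fin.val_ne_of_ne hg; omega), h.X]
      simp [hX g' hg]
  all_goals intros; rw [key _ (by omega)]
  exacts [h.num_agents, h.num_goods, h.one, h.base_o, h.base_X, h.base_R, h.base_d, h.flag, h.lvl,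
    h.agt, h.good, h.thr, h.o _, h.R _, h.d _]

theorem update_R (h : Repr M s) (g : Fin m) (k : ℕ) (R : Finset (Fin m))
    (hk : k = if g ∈ R then 1 else 0) (hR : ∀ g', g' ≠ g → (g' ∈ R ↔ g' ∈ s.R)) :
    Repr (Function.update M (16 + 3 * m + g) k) { s with R := R } := by
  have key : ∀ y, y ≠ 16 + 3 * m + g → Function.update M (16 + 3 * m + g) k y = M y :=
    fun y hy => Function.update_of_ne hy _ _
  refine ⟨?_, ?_, ?_, ?_, ?_, ?_, ?_, ?_, ?_, ?_, ?_, ?_, ?_, ?_, fun g' => ?_, ?_⟩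
  case refine_15 =>
    by_cases hg : g' = g
    · subst hg; simp [hk]
    · rw [key _ (by have := Fin.val_ne_of_ne hg; omega), h.R]
      simp [hR g' hg]
  all_goals intros; rw [key _ (by omega)]
  exacts [h.num_agents, h.num_goods, h.one, h.base_o, h.base_X, h.base_R, h.base_d, h.flag, h.lvl,
    h.agt, h.good, h.thr, h.o _, h.X _, h.d _]

end Repr

/-! ### Elementary operations on the data structures -/

namespace Program

/-- `M[x] := M[y]` -/
def copy (x y : ℕ) : Program := .seq (.const 12 0) (.add x y 12)

/-- Write cell `y` into the entry of the current good in the array with base `M[b]`. -/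
def setGood (b y : ℕ) : Program := .seq (.add 15 b 10) (.store 15 y)

/-- Read the entry of the current good of the indicator vector `R`. -/
def getR : Program := .seq (.add 15 5 10) (.load 13 15)

/-- Write cell `y` into the entry of the current agent of the array `d`. -/
def setD (y : ℕ) : Program := .seq (.add 15 6 9) (.store 15 y)

/-- Read the entry of the current agent of the array `d`. -/
def getD : Program := .seq (.add 15 6 9) (.load 13 15)

/-- Set cell `12` to the amount by which the value that the current agent has for the set with
base `M[b]` falls short of the threshold. -/
def shortfall (b : ℕ) : Program := .seq (.query 12 9 b) (.sub 12 14 12)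

/-- Put the initial memory into the form that represents a state. -/
def setup : Program :=
  .seq (.const 2 1) <| .seq (.const 12 16) <| .seq (.add 3 12 1) <| .seq (.add 4 3 1) <|
    .seq (.add 5 4 1) (.add 6 5 1)

end Program

section Operations

variable {n m : ℕ} {v : Fin n → Valuation m} {M : Memory} {s : State n m}
  {Q : ℕ → Memory → Prop}

theorem wp_copy {x y : ℕ} (hy : y ≠ 12)
    (hQ : Q 2 (Function.update (Function.update M 12 0) x (M y))) :
    Wp v (.copy x y) M Q := by
  refine wp_seq (wp_const (wp_add ?_))
  rwa [Function.update_self, Function.update_of_ne hy, Nat.add_zero]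

theorem wp_setGood_X (h : Repr M s) (g : Fin m) (hg : s.good = g) {y k : ℕ} (hy : y ≠ 15)
    (hk : M y = k) (X : Finset (Fin m)) (hX : k = if g ∈ X then 1 else 0)
    (hX' : ∀ g', g' ≠ g → (g' ∈ X ↔ g' ∈ s.X))
    (hQ : ∀ M', Repr M' { s with X := X } → Q 2 M') : Wp v (.setGood 4 y) M Q := by
  refine wp_seq (wp_add (wp_store (a := 16 + 2 * m + g) ?_ (hQ _ ?_)))
  · simp [h.base_X, h.good, hg]
  · rw [Function.update_of_ne hy, hk]
    exact (h.update_temp (by simp) _).update_X g k X hX hX'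

theorem wp_setGood_R (h : Repr M s) (g : Fin m) (hg : s.good = g) {y k : ℕ} (hy : y ≠ 15)
    (hk : M y = k) (R : Finset (Fin m)) (hR : k = if g ∈ R then 1 else 0)
    (hR' : ∀ g', g' ≠ g → (g' ∈ R ↔ g' ∈ s.R))
    (hQ : ∀ M', Repr M' { s with R := R } → Q 2 M') : Wp v (.setGood 5 y) M Q := by
  refine wp_seq (wp_add (wp_store (a := 16 + 3 * m + g) ?_ (hQ _ ?_)))
  · simp [h.base_R, h.good, hg]
  · rw [Function.update_of_ne hy, hk]
    exact (h.update_temp (by simp) _).update_R g k R hR hR'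

theorem wp_setGood_o (h : Repr M s) (g : Fin m) (hg : s.good = g) (i : Fin n) (hi : s.agt = i)
    (hQ : ∀ M', Repr M' { s with o := Function.update s.o g i } → Q 2 M') :
    Wp v (.setGood 3 9) M Q := by
  refine wp_seq (wp_add (wp_store (a := 16 + m + g) ?_ (hQ _ ?_)))
  · simp [h.base_o, h.good, hg]
  · rw [Function.update_of_ne (by norm_num), h.agt.trans hi]
    exact (h.update_temp (x := 15) (by simp) _).update_o g i

theorem wp_getR (h : Repr M s) (g : Fin m) (hg : s.good = g)
    (hQ : ∀ M', Repr M' s → M' 13 = (if g ∈ s.R then 1 else 0) → Q 2 M') :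
    Wp v .getR M Q := by
  refine wp_seq (wp_add (wp_load (hQ _ ((h.update_temp (by simp) _).update_temp (by simp) _) ?_)))
  rw [Function.update_self, Function.update_self, h.base_R, h.good, hg,
    Function.update_of_ne (by omega), h.R]

theorem wp_setD (h : Repr M s) (i : Fin n) (hi : s.agt = i) {y k : ℕ} (hy : y ≠ 15)
    (hk : M y = k)
    (hQ : ∀ M', Repr M' { s with d := Function.update s.d i k } → Q 2 M') :
    Wp v (.setD y) M Q := by
  refine wp_seq (wp_add (wp_store (a := 16 + 4 * m + i) ?_ (hQ _ ?_)))
  · simp [h.base_d, h.agt, hi]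
  · rw [Function.update_of_ne hy, hk]
    exact (h.update_temp (by simp) _).update_d i k

theorem wp_getD (h : Repr M s) (i : Fin n) (hi : s.agt = i)
    (hQ : ∀ M', Repr M' s → M' 13 = s.d i → Q 2 M') : Wp v .getD M Q := by
  refine wp_seq (wp_add (wp_load (hQ _ ((h.update_temp (by simp) _).update_temp (by simp) _) ?_)))
  rw [Function.update_self, Function.update_self, h.base_d, h.agt, hi,
    Function.update_of_ne (by omega), h.d]

variable {w : Fin n → Finset (Fin m) → ℕ}

theorem wp_shortfall_X (hw : ∀ i S, v i S = w i S) (h : Repr M s) (i : Fin n) (hi : s.agt = i)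
    (hQ : ∀ M', Repr M' s → M' 12 = s.thr - w i s.X → Q (m + 2) M') :
    Wp v (.shortfall 4) M Q := by
  refine wp_seq (wp_query hw (i := i) (S := s.X) (h.agt.trans hi) ?_ (wp_sub (hQ _
    ((h.update_temp (by simp) _).update_temp (by simp) _) ?_)))
  · rw [h.base_X, h.storedSet_X]
  · simp [h.thr]

theorem wp_shortfall_R (hw : ∀ i S, v i S = w i S) (h : Repr M s) (i : Fin n) (hi : s.agt = i)
    (hQ : ∀ M', Repr M' s → M' 12 = s.thr - w i s.R → Q (m + 2) M') :
    Wp v (.shortfall 5) M Q := by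
  refine wp_seq (wp_query hw (i := i) (S := s.R) (h.agt.trans hi) ?_ (wp_sub (hQ _
    ((h.update_temp (by simp) _).update_temp (by simp) _) ?_)))
  · rw [h.base_R, h.storedSet_R]
  · simp [h.thr]

theorem wp_setup (hn : 0 < n)
    (hQ : ∀ M', Repr M' (⟨fun _ => 0, ∅, ∅, fun _ => ⟨0, hn⟩, 0, 0, 0, 0, 0⟩ : State n m) →
      Q 6 M') : Wp v .setup (inputMemory n m) Q := by
  refine wp_seq (wp_const (wp_seq (wp_const (wp_seq (wp_add (wp_seq (wp_add (wp_seq (wp_add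
    (wp_add (hQ _ ?_)))))))))))
  have key : ∀ x, 7 ≤ x → inputMemory n m x = 0 := by
    intro x hx
    simp [inputMemory, show x ≠ 0 by omega, show x ≠ 1 by omega]
  have h1 : inputMemory n m 1 = m := rfl
  constructor
  case num_agents => rfl
  case num_goods => rfl
  case one => rfl
  case o | X | R | d =>
    intro g
    repeat rw [Function.update_of_ne (by omega)]
    rw [key _ (by omega)]
    try simp
  case flag | lvl | agt | good | thr => simp [key]
  case base_o => simp [h1]
  all_goals
    simp [h1]
    omega

end Operations

/-! ### Loops over the goods and the agents -/

namespace Program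

/-- Repeat `c` for each good. -/
def forGoods (c : Program) : Program := .seq (.copy 10 1) (.loop 10 (.seq (.sub 10 10 2) c))

/-- Repeat `c` for each agent. -/
def forAgents (c : Program) : Program := .seq (.copy 9 0) (.loop 9 (.seq (.sub 9 9 2) c))

end Program

section Loops

variable {n m : ℕ} {v : Fin n → Valuation m} {M : Memory} {s : State n m} {c : Program} {T : ℕ}

/-- The counter runs down, so `I k` describes the moment when the goods from `k` on are done. The
body starts with the counter already lowered to `g`. Per round, the decrement and the loop test cost
`2` beyond `T`. -/
theorem wp_forGoods (I : ℕ → State n m → Prop) (hI : ∀ k s, I k s → s.good = k)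
    (step : ∀ (g : Fin m) M s, I (g + 1) s → Repr M { s with good := g } →
      Wp v c M fun t M' => t ≤ T ∧ ∃ s', I g s' ∧ Repr M' s')
    (h : Repr M s) (h0 : I m { s with good := m }) :
    Wp v (.forGoods c) M fun t M' => t ≤ m * (T + 2) + 3 ∧ ∃ s', I 0 s' ∧ Repr M' s' := by
  refine wp_seq (wp_copy (by norm_num) ?_)
  rw [h.num_goods]
  refine (wp_countdown (v := v) (T := T + 1)
    (fun k M => k ≤ m ∧ ∃ s : State n m, I k s ∧ Repr M s) ?_ ?_ m _
    ⟨le_rfl, _, h0, (h.update_temp (by simp) _).update_good m⟩).imp ?_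
  · rintro k M ⟨-, s, hs, hM⟩
    rw [hM.good, hI k s hs]
  · rintro k M ⟨hk, s, hs, hM⟩
    have e : M 10 - M 2 = k := by simp [hM.good, hM.one, hI _ _ hs]
    refine wp_seq (wp_sub ?_)
    rw [e]
    refine (step ⟨k, hk⟩ _ s hs (hM.update_good k)).imp ?_
    rintro t M' ⟨ht, s', hs'⟩
    exact ⟨by omega, by omega, s', hs'⟩
  · rintro t M' ⟨ht, -, hs'⟩
    simp only [add_assoc, Nat.reduceAdd] at ht
    exact ⟨by omega, hs'⟩

theorem wp_forAgents (I : ℕ → State n m → Prop) (hI : ∀ k s, I k s → s.agt = k)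
    (step : ∀ (i : Fin n) M s, I (i + 1) s → Repr M { s with agt := i } →
      Wp v c M fun t M' => t ≤ T ∧ ∃ s', I i s' ∧ Repr M' s')
    (h : Repr M s) (h0 : I n { s with agt := n }) :
    Wp v (.forAgents c) M fun t M' => t ≤ n * (T + 2) + 3 ∧ ∃ s', I 0 s' ∧ Repr M' s' := by
  refine wp_seq (wp_copy (by norm_num) ?_)
  rw [h.num_agents]
  refine (wp_countdown (v := v) (T := T + 1)
    (fun k M => k ≤ n ∧ ∃ s : State n m, I k s ∧ Repr M s) ?_ ?_ n _
    ⟨le_rfl, _, h0, (h.update_temp (by simp) _).update_agt n⟩).imp ?_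
  · rintro k M ⟨-, s, hs, hM⟩
    rw [hM.agt, hI k s hs]
  · rintro k M ⟨hk, s, hs, hM⟩
    have e : M 9 - M 2 = k := by simp [hM.agt, hM.one, hI _ _ hs]
    refine wp_seq (wp_sub ?_)
    rw [e]
    refine (step ⟨k, hk⟩ _ s hs (hM.update_agt k)).imp ?_
    rintro t M' ⟨ht, s', hs'⟩
    exact ⟨by omega, by omega, s', hs'⟩
  · rintro t M' ⟨ht, -, hs'⟩
    simp only [add_assoc, Nat.reduceAdd] at ht
    exact ⟨by omega, hs'⟩

end Loops

/-! ### Serving one agent -/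

namespace Program

/-- Drop the current good from `X` if `X` still reaches the threshold without it; otherwise hand it
over to the current agent. -/
def shrinkStep : Program :=
  .seq (.const 12 0) <| .seq (.setGood 4 12) <| .seq (.shortfall 4) <|
    .branch 12
      (.seq (.setGood 4 2) <| .seq (.const 12 0) <| .seq (.setGood 5 12) (.setGood 3 9)) .skip

/-- Give the current agent a minimal set of remaining goods that reaches the threshold. -/
def take : Program := .seq (.forGoods (.seq .getR (.setGood 4 13))) (.forGoods shrinkStep)

/-- If the target of the current agent is the threshold, then serve the agent, or lower the target
and raise the flag. -/
def agentStep : Program :=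
  .seq .getD <| .seq (.sub 12 13 8) <| .seq (.sub 13 8 13) <| .seq (.add 12 12 13) <|
    .branch 12 .skip <| .seq (.shortfall 5) <|
      .branch 12 (.seq .getD <| .seq (.add 13 13 2) <| .seq (.setD 13) (.const 7 1)) take

end Program

section Serving

variable {n m : ℕ} {v : Fin n → Valuation m} {w : Fin n → Finset (Fin m) → ℕ} {M : Memory}
  {s : State n m}

theorem wp_copy_R_to_X (h : Repr M s) :
    Wp v (.forGoods (.seq .getR (.setGood 4 13))) M fun t M' => t ≤ m * 6 + 3 ∧
      Repr M' { s with X := s.R, good := 0 } := by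
  refine (wp_forGoods (v := v) (T := 4) (fun k s' => ∃ X, s' = { s with good := k, X := X } ∧
    ∀ g : Fin m, k ≤ g → (g ∈ X ↔ g ∈ s.R)) ?_ ?_ h
    ⟨s.X, rfl, fun g hg => absurd g.isLt (by omega)⟩).imp ?_
  · rintro k _ ⟨X, rfl, -⟩
    rfl
  · rintro g M _ ⟨X, rfl, hX⟩ hM
    refine wp_seq (wp_getR hM g rfl fun M₁ h₁ e₁ => ?_)
    refine wp_setGood_X h₁ g rfl (by norm_num) e₁
      (if g ∈ s.R then insert g X else X.erase g) ?_ ?_ fun M₂ h₂ => ?_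
    · by_cases hg : g ∈ s.R <;> simp [hg]
    · intro g' hg'
      by_cases hg : g ∈ s.R <;> simp [hg, hg']
    · refine ⟨le_rfl, _, ⟨_, rfl, fun g' hg' => ?_⟩, h₂⟩
      by_cases e : g' = g
      · subst e
        by_cases hg : g' ∈ s.R <;> simp [hg]
      · have h3 : (g : ℕ) + 1 ≤ g' := by
          have := Fin.val_ne_of_ne e
          omega
        by_cases hg : g ∈ s.R <;> simp [hg, e, hX g' h3]
  · rintro t M' ⟨ht, _, ⟨X, rfl, hX⟩, hM'⟩
    obtain rfl : X = s.R := Finset.ext fun g => hX g (Nat.zero_le _)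
    exact ⟨ht, hM'⟩

/-- The state while the scratch set is shrunk, after the goods from `k` on have been treated. -/
def State.shrinking (s : State n m) (i : Fin n) (k : ℕ) (X : Finset (Fin m)) : State n m :=
  { s with
    good := k
    X := X
    R := s.R \ X.filter fun g => k ≤ (g : ℕ)
    o := fun g => if g ∈ X ∧ k ≤ (g : ℕ) then i else s.o g }

/-- One greedy sweep yields a minimal set: by monotonicity, a good that was critical when it was
kept stays critical as further goods are dropped. -/
theorem wp_take (hw : ∀ i S, v i S = w i S) (hmono : ∀ i, Monotone (w i)) (h : Repr M s)
    (i : Fin n) (hi : s.agt = i) (hR : s.thr ≤ w i s.R) :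
    Wp v .take M fun t M' => t ≤ m * (m + 21) + 6 ∧ ∃ X ⊆ s.R, s.thr ≤ w i X ∧
      (∀ g ∈ X, w i (X.erase g) < s.thr) ∧
      Repr M' { s with
        good := 0
        X := X
        R := s.R \ X
        o := fun g => if g ∈ X then i else s.o g } := by
  refine wp_seq ((wp_copy_R_to_X h).imp fun t₁ M₁ ⟨ht₁, h₁⟩ => ?_)
  refine (wp_forGoods (v := v) (T := m + 13) (fun k s' => ∃ X ⊆ s.R, s.thr ≤ w i X ∧
    (∀ g ∈ X, k ≤ (g : ℕ) → w i (X.erase g) < s.thr) ∧ s' = s.shrinking i k X) ?_ ?_ h₁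
    ⟨s.R, subset_rfl, hR, fun g _ hg => absurd g.isLt (by omega), ?_⟩).imp ?_
  · rintro k _ ⟨X, -, -, -, rfl⟩
    rfl
  · rintro g M _ ⟨X, hXR, hX, hcrit, rfl⟩ hM
    refine wp_seq (wp_const (wp_seq (wp_setGood_X (hM.update_temp (.inl rfl) 0) g rfl (by norm_num)
      (Function.update_self _ _ _) (X.erase g) (by simp)
      (fun g' hg' => by simp [State.shrinking, hg']) fun M₂ h₂ => ?_)))
    refine wp_seq (wp_shortfall_X hw h₂ i hi fun M₃ h₃ e₃ => wp_branch (fun hx => ?_) fun hx => ?_)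
    · have hlt : w i (X.erase g) < s.thr := by
        rw [e₃] at hx
        exact Nat.lt_of_sub_ne_zero hx
      -- Deleting a good outside `X` changes nothing and cannot cause a shortfall.
      have hg : g ∈ X := by
        by_contra hg
        rw [Finset.erase_eq_of_notMem hg] at hlt
        omega
      refine wp_seq (wp_setGood_X h₃ g rfl (by norm_num) h₃.one X (by simp [hg])
        (fun g' hg' => by simp [hg']) fun M₄ h₄ => ?_)
      refine wp_seq (wp_const (wp_seq (wp_setGood_R (h₄.update_temp (.inl rfl) 0) g rfl
        (by norm_num) (Function.update_self _ _ _) (s.R \ X.filter fun g' => (g : ℕ) ≤ g')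
        (by simp [hg]) (fun g' hg' => ?_) fun M₅ h₅ => wp_setGood_o h₅ g rfl i hi fun M₆ h₆ => ?_)))
      · have : ((g : ℕ) ≤ g' ↔ (g : ℕ) + 1 ≤ g') := by
          have := Fin.val_ne_of_ne hg'
          omega
        simp only [State.shrinking, Finset.mem_sdiff, Finset.mem_filter, this]
      · refine ⟨by omega, _, ⟨X, hXR, hX, fun g' hg' hle => ?_, rfl⟩, ?_⟩
        · by_cases e : g' = g
          · exact e ▸ hlt
          · exact hcrit g' hg' (by have := Fin.val_ne_of_ne e; omega)
        · convert h₆ using 1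
          simp only [State.shrinking, State.mk.injEq, true_and, and_true]
          ext1 g'
          by_cases e : g' = g
          · subst e
            simp [hg]
          · have : ((g : ℕ) ≤ g' ↔ (g : ℕ) + 1 ≤ g') := by
              have := Fin.val_ne_of_ne e
              omega
            simp [Function.update_of_ne e, this]
    · refine wp_skip ⟨by omega, _, ⟨X.erase g, (Finset.erase_subset g X).trans hXR, ?_, ?_, rfl⟩, ?_⟩
      · rw [e₃] at hx
        exact Nat.sub_eq_zero_iff_le.1 hx
      · intro g' hg' hle
        have e := Finset.ne_of_mem_erase hg'
        exact (hmono i (Finset.erase_subset_erase _ (Finset.erase_subset _ _))).trans_lt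
          (hcrit g' (Finset.mem_of_mem_erase hg') (by have := Fin.val_ne_of_ne e; omega))
      · have key : ∀ g' : Fin m, (g' ∈ X.erase g ∧ (g : ℕ) ≤ g') ↔ (g' ∈ X ∧ (g : ℕ) + 1 ≤ g') := by
          intro g'
          rw [Finset.mem_erase, ← Fin.val_ne_iff]
          constructor <;> rintro ⟨h1, h2⟩
          · exact ⟨h1.2, by omega⟩
          · exact ⟨⟨by omega, h1⟩, by omega⟩
        convert h₃ using 1
        simp only [State.shrinking, State.mk.injEq, true_and, and_true, key]
        ext g'
        simp only [Finset.mem_sdiff, Finset.mem_filter, key]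
  -- No good has index `m` or more, so at the start `State.shrinking` changes neither `R` nor `o`.
  · have key : ∀ g : Fin m, ¬ m ≤ (g : ℕ) := fun g => by omega
    simp [State.shrinking, key]
  · rintro t M' ⟨ht, _, ⟨X, hXR, hX, hcrit, rfl⟩, hM'⟩
    refine ⟨?_, X, hXR, hX, fun g hg => hcrit g hg (Nat.zero_le _), ?_⟩
    · have : m * (m + 21) = m * 6 + m * (m + 13 + 2) := by ring
      omega
    · simpa [State.shrinking] using hM'

/-- The possible effects of the turn of agent `i`. -/
inductive Turn (w : Fin n → Finset (Fin m) → ℕ) (i : Fin n) (s : State n m) : State n m → Prop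
  | idle (h : s.d i ≠ s.lvl) : Turn w i s s
  | fail (h : s.d i = s.lvl) (hR : w i s.R < s.thr) :
      Turn w i s { s with d := Function.update s.d i (s.lvl + 1), flag := 1 }
  | take (h : s.d i = s.lvl) (X : Finset (Fin m)) (hX : X ⊆ s.R) (hthr : s.thr ≤ w i X)
      (hcrit : ∀ g ∈ X, w i (X.erase g) < s.thr) :
      Turn w i s { s with
        good := 0
        X := X
        R := s.R \ X
        o := fun g => if g ∈ X then i else s.o g }

theorem wp_agentStep (hw : ∀ i S, v i S = w i S) (hmono : ∀ i, Monotone (w i)) (h : Repr M s)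
    (i : Fin n) (hi : s.agt = i) :
    Wp v .agentStep M fun t M' => t ≤ m * (m + 22) + 20 ∧ ∃ s', Turn w i s s' ∧ Repr M' s' := by
  have hT : m * (m + 22) = m * (m + 21) + m := by ring
  refine wp_seq (wp_getD h i hi fun M₁ h₁ e₁ => wp_seq (wp_sub (wp_seq (wp_sub (wp_seq
    (wp_add ?_))))))
  have e₂ : ∀ x, x ≠ 12 → x ≠ 13 → ∀ a b c, Function.update (Function.update (Function.update
      M₁ 12 a) 13 b) 12 c x = M₁ x := fun x h12 h13 a b c => by
    rw [Function.update_of_ne h12, Function.update_of_ne h13, Function.update_of_ne h12]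
  have h₂ := fun a b c => ((h₁.update_temp (.inl rfl) a).update_temp (.inr (.inl rfl)) b).update_temp
    (.inl rfl) c
  have h12 : M₁ 8 = s.lvl := h₁.lvl
  -- The tested cell is the sum of both truncated differences of `d i` and `lvl`, which vanishes
  -- exactly when they are equal.
  refine wp_branch (fun hx => ?_) fun hx => ?_
  · refine wp_skip ⟨by omega, s, .idle ?_, h₂ _ _ _⟩
    simp [h12, e₁] at hx
    omega
  · have hd : s.d i = s.lvl := by
      simp [h12, e₁] at hx
      omega
    refine wp_seq (wp_shortfall_R hw (h₂ _ _ _) i hi fun M₃ h₃ e₃ => wp_branch (fun hx' => ?_)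
      fun hx' => ?_)
    · refine wp_seq (wp_getD h₃ i hi fun M₄ h₄ e₄ => wp_seq (wp_add (wp_seq (wp_setD
        (k := s.lvl + 1) (h₄.update_temp (.inr (.inl rfl)) _) i hi (by norm_num) ?_
        fun M₅ h₅ => wp_const ⟨by omega, _, .fail hd ?_, h₅.update_flag 1⟩))))
      · rw [Function.update_self, e₄, h₄.one, hd]
      · rw [e₃] at hx'
        exact Nat.lt_of_sub_ne_zero hx'
    · refine (wp_take hw hmono h₃ i hi ?_).imp ?_
      · rw [e₃] at hx'
        exact Nat.sub_eq_zero_iff_le.1 hx'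
      · rintro t M' ⟨ht, X, hXR, hX, hcrit, hM'⟩
        exact ⟨by omega, _, .take hd X hXR hX hcrit, hM'⟩

end Serving

/-! ### Invariants of a pass -/

section Invariants

variable {n m : ℕ}

/-- The goods that agent `j` has taken when the goods in `R` remain. -/
def takenBy (R : Finset (Fin m)) (o : Fin m → Fin n) (j : Fin n) : Finset (Fin m) :=
  Finset.univ.filter fun g => g ∉ R ∧ o g = j

/-- The targets `m + 1 - d j` are between `0` and `m`, and at least half the AnyPrice shares. -/
structure TargetsValid (v : Fin n → Valuation m) (d : Fin n → ℕ) : Prop where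
  pos : ∀ j, 1 ≤ d j
  le : ∀ j, d j ≤ m + 1
  aps : ∀ j, APS n (v j) + 2 * d j ≤ 2 * (m + 1)

/-- The invariant of a pass, when the agents `j` with `d j > c`, and those with `d j = c` and
`j ≥ k`, have had their turns. The sum of `d` was `Φ` at the start of the pass. -/
structure PassInvariant (v : Fin n → Valuation m) (w : Fin n → Finset (Fin m) → ℕ) (Φ c k : ℕ)
    (d : Fin n → ℕ) (R : Finset (Fin m)) (o : Fin m → Fin n) (flag : ℕ) : Prop where
  valid : TargetsValid v d
  card_le : ∀ j, (takenBy R o j).card + c ≤ m + 1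
  empty : ∀ j : Fin n, d j < c ∨ d j = c ∧ (j : ℕ) < k → takenBy R o j = ∅
  -- Nothing is claimed once the flag is up: an agent that failed has taken nothing, and the pass
  -- will be repeated.
  served : flag = 0 → ∀ j : Fin n, c < d j ∨ d j = c ∧ k ≤ (j : ℕ) →
    m + 1 ≤ w j (takenBy R o j) + d j
  sum_le : Φ ≤ ∑ j, d j
  sum_lt : flag ≠ 0 → Φ < ∑ j, d j

theorem card_compl_eq_sum_takenBy (R : Finset (Fin m)) (o : Fin m → Fin n) :
    Rᶜ.card = ∑ j, (takenBy R o j).card := by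
  rw [Finset.card_eq_sum_card_fiberwise (f := o) (t := Finset.univ) fun _ _ => by simp]
  refine Finset.sum_congr rfl fun j _ => congrArg _ ?_
  ext g
  simp [takenBy]

namespace PassInvariant

variable {v : Fin n → Valuation m} {w : Fin n → Finset (Fin m) → ℕ} {Φ c k flag : ℕ}
  {d : Fin n → ℕ} {R : Finset (Fin m)} {o : Fin m → Fin n}

/-- Only agents with `d j = m + 1` count as treated, and their target is `0`. The map `o` may hold
stale owners from an earlier pass; `takenBy` ignores them because all goods are back in `R`. -/
theorem start (hd : TargetsValid v d) (o : Fin m → Fin n) :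
    PassInvariant v w (∑ j, d j) m n d Finset.univ o 0 where
  valid := hd
  card_le j := by simp [takenBy]
  empty j _ := by simp [takenBy]
  served _ j hj := by
    have := j.isLt
    omega
  sum_le := le_rfl
  sum_lt h := absurd rfl h

theorem next_level (h : PassInvariant v w Φ (c + 1) 0 d R o flag) :
    PassInvariant v w Φ c n d R o flag where
  valid := h.valid
  card_le j := by
    have := h.card_le j
    omega
  empty j hj := h.empty j (by omega)
  served hf j hj := h.served hf j (by
    have := j.isLt
    omega)
  sum_le := h.sum_le
  sum_lt := h.sum_lt

theorem idle {i : Fin n} (h : PassInvariant v w Φ c (i + 1) d R o flag) (hi : d i ≠ c) :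
    PassInvariant v w Φ c i d R o flag where
  valid := h.valid
  card_le := h.card_le
  empty j hj := h.empty j (by omega)
  served hf j hj := h.served hf j (by
    rcases hj with hj | ⟨hj, hij⟩
    · exact .inl hj
    · have : (i : ℕ) ≠ j := fun e => hi (by rw [Fin.ext e, hj])
      omega)
  sum_le := h.sum_le
  sum_lt := h.sum_lt

/-- This is where the bound on the share enters, with `ℓ = m + 1 - c`: agent `i` has taken nothing
and the others at most `ℓ` goods each. With its new entry `c + 1`, agent `i` counts as treated. -/
theorem fail {i : Fin n} (h : PassInvariant v w Φ c (i + 1) d R o flag) (hi : d i = c) (hc : c ≤ m)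
    (hw : ∀ i S, v i S = w i S) (hxos : ∀ i, IsUnitXOS (w i)) (hR : w i R < m + 1 - c) :
    PassInvariant v w Φ c i (Function.update d i (c + 1)) R o 1 where
  valid := by
    refine ⟨fun j => ?_, fun j => ?_, fun j => ?_⟩ <;> by_cases e : j = i
    · simp [e]
    · simpa [e] using h.valid.pos j
    · simpa [e] using hc
    · simpa [e] using h.valid.le j
    · subst e
      have hcard : Rᶜ.card ≤ (n - 1) * (m + 1 - c) := by
        rw [card_compl_eq_sum_takenBy R o, ← Finset.add_sum_erase _ _ (Finset.mem_univ j),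
          h.empty j (.inr ⟨hi, Nat.lt_succ_self _⟩), Finset.card_empty, zero_add]
        refine (Finset.sum_le_card_nsmul _ _ (m + 1 - c) fun j' _ => ?_).trans ?_
        · have := h.card_le j'
          omega
        · simp
      have key := APS_le_add (hw j) (hxos j) j.pos R hcard hR
      rw [Nat.cast_sub (by omega)] at key
      push_cast [Function.update_self] at key ⊢
      linarith
    · simpa [e] using h.valid.aps j
  card_le := h.card_le
  empty j hj := by
    by_cases e : j = i
    · subst e
      simp at hj
    · rw [Function.update_of_ne e] at hj
      exact h.empty j (by omega)
  served hf := absurd hf one_ne_zero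
  sum_le := h.sum_le.trans (Finset.sum_le_sum fun j _ => by
    by_cases e : j = i
    · simp [e, hi]
    · simp [e])
  sum_lt _ := h.sum_le.trans_lt (Finset.sum_lt_sum (fun j _ => by
    by_cases e : j = i
    · simp [e, hi]
    · simp [e]) ⟨i, Finset.mem_univ i, by simp [hi]⟩)

theorem take {i : Fin n} (h : PassInvariant v w Φ c (i + 1) d R o flag) (hi : d i = c)
    {X : Finset (Fin m)} (hX : X ⊆ R) (hval : m + 1 - c ≤ w i X) (hcard : X.card ≤ m + 1 - c) :
    PassInvariant v w Φ c i d (R \ X) (fun g => if g ∈ X then i else o g) flag := by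
  have hempty := h.empty i (.inr ⟨hi, Nat.lt_succ_self _⟩)
  have hc : c ≤ m + 1 := hi ▸ h.valid.le i
  -- Agent `i` had nothing before its turn, so its goods are now exactly `X`. The other bundles are
  -- untouched because `X` comes from `R`.
  have hself : takenBy (R \ X) (fun g => if g ∈ X then i else o g) i = X := by
    ext g
    have hg : g ∉ takenBy R o i := by simp [hempty]
    by_cases hgX : g ∈ X
    · simp [takenBy, hgX]
    · simpa [takenBy, hgX] using hg
  have hother : ∀ j, j ≠ i →
      takenBy (R \ X) (fun g => if g ∈ X then i else o g) j = takenBy R o j := by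
    intro j hj
    ext g
    by_cases hgX : g ∈ X
    · simp [takenBy, hgX, hX hgX, hj.symm]
    · simp [takenBy, hgX]
  refine ⟨h.valid, fun j => ?_, fun j hj => ?_, fun hf j hj => ?_, h.sum_le, h.sum_lt⟩
  · by_cases e : j = i
    · rw [e, hself]
      omega
    · rw [hother j e]
      exact h.card_le j
  · have e : j ≠ i := by
      rintro rfl
      omega
    rw [hother j e]
    exact h.empty j (by omega)
  · by_cases e : j = i
    · rw [e, hself]
      omega
    · rw [hother j e]
      refine h.served hf j ?_
      have := Fin.val_ne_of_ne e
      omega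

theorem turn {s s' : State n m} {i : Fin n}
    (h : PassInvariant v w Φ c (i + 1) s.d s.R s.o s.flag) (hlvl : s.lvl = c)
    (hthr : s.thr = m + 1 - c) (hc : c ≤ m) (hw : ∀ i S, v i S = w i S)
    (hxos : ∀ i, IsUnitXOS (w i)) (ht : Turn w i s s') :
    PassInvariant v w Φ c i s'.d s'.R s'.o s'.flag ∧ s'.lvl = s.lvl ∧ s'.thr = s.thr ∧
      s'.agt = s.agt := by
  subst hlvl
  cases ht with
  | idle hi => exact ⟨h.idle hi, rfl, rfl, rfl⟩
  | fail hi hR => exact ⟨h.fail hi hc hw hxos (hthr ▸ hR), rfl, rfl, rfl⟩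
  | take hi X hX hval hcrit =>
    exact ⟨h.take hi hX (hthr ▸ hval) (hthr ▸ (hxos i).card_le X _ hval hcrit), rfl, rfl, rfl⟩

end PassInvariant

end Invariants

/-! ### Passes -/

namespace Program

/-- Serve the agents in the order of their targets. -/
def pass : Program :=
  .seq (.const 7 0) <| .seq (.forGoods (.setGood 5 2)) <| .seq (.copy 8 1) <|
    .loop 8 <| .seq (.add 14 1 2) <| .seq (.sub 14 14 8) <| .seq (.forAgents .agentStep)
      (.sub 8 8 2)

/-- Set the targets to `m`, and make passes until all agents are served. -/
def allocate : Program :=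
  .seq .setup <| .seq (.forAgents (.setD 2)) <| .seq (.const 7 1) (.loop 7 pass)

end Program

/-- A bound on the running time of a pass. -/
def passTime (n m : ℕ) : ℕ := m * (n * (m * (m + 22) + 22) + 10) + m * 4 + 10

section Passes

variable {n m : ℕ} {v : Fin n → Valuation m} {w : Fin n → Finset (Fin m) → ℕ} {M : Memory}
  {s : State n m}

theorem wp_fill_R (h : Repr M s) :
    Wp v (.forGoods (.setGood 5 2)) M fun t M' => t ≤ m * 4 + 3 ∧
      Repr M' { s with R := Finset.univ, good := 0 } := by
  refine (wp_forGoods (v := v) (T := 2) (fun k s' => ∃ R, s' = { s with good := k, R := R } ∧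
    ∀ g : Fin m, k ≤ g → g ∈ R) ?_ ?_ h
    ⟨s.R, rfl, fun g hg => absurd g.isLt (by omega)⟩).imp ?_
  · rintro k _ ⟨R, rfl, -⟩
    rfl
  · rintro g M _ ⟨R, rfl, hR⟩ hM
    refine wp_setGood_R hM g rfl (by norm_num) hM.one (insert g R) (by simp)
      (fun g' hg' => by simp [hg']) fun M₂ h₂ => ⟨le_rfl, _, ⟨_, rfl, fun g' hg' => ?_⟩, h₂⟩
    by_cases e : g' = g
    · simp [e]
    · exact Finset.mem_insert_of_mem (hR g' (by have := Fin.val_ne_of_ne e; omega))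
  · rintro t M' ⟨ht, _, ⟨R, rfl, hR⟩, hM'⟩
    obtain rfl : R = Finset.univ := Finset.eq_univ_iff_forall.2 fun g => hR g (Nat.zero_le _)
    exact ⟨ht, hM'⟩

theorem wp_level (hw : ∀ i S, v i S = w i S) (hxos : ∀ i, IsUnitXOS (w i)) {Φ c : ℕ}
    (hc : c ≤ m) (h : Repr M s) (hlvl : s.lvl = c) (hthr : s.thr = m + 1 - c)
    (hinv : PassInvariant v w Φ c n s.d s.R s.o s.flag) :
    Wp v (.forAgents .agentStep) M fun t M' => t ≤ n * (m * (m + 22) + 22) + 3 ∧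
      ∃ s' : State n m, s'.lvl = c ∧ PassInvariant v w Φ c 0 s'.d s'.R s'.o s'.flag ∧
        Repr M' s' := by
  refine (wp_forAgents (v := v) (T := m * (m + 22) + 20) (fun k s' => s'.agt = k ∧ s'.lvl = c ∧
    s'.thr = m + 1 - c ∧ PassInvariant v w Φ c k s'.d s'.R s'.o s'.flag) (fun k s' hs => hs.1) ?_ h
    ⟨rfl, hlvl, hthr, hinv⟩).imp ?_
  · rintro i M s' ⟨-, hlvl', hthr', hinv'⟩ hM
    refine (wp_agentStep hw (fun i => (hxos i).mono) hM i rfl).imp ?_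
    rintro t M' ⟨ht, s'', hturn, hM'⟩
    obtain ⟨h1, h2, h3, h4⟩ := PassInvariant.turn (s := { s' with agt := i }) hinv' hlvl' hthr' hc
      hw hxos hturn
    exact ⟨ht, s'', ⟨h4, h2.trans hlvl', h3.trans hthr', h1⟩, hM'⟩
  · rintro t M' ⟨ht, s', ⟨-, h2, -, h4⟩, hM'⟩
    exact ⟨ht, s', h2, h4, hM'⟩

theorem wp_pass (hw : ∀ i S, v i S = w i S) (hxos : ∀ i, IsUnitXOS (w i)) (h : Repr M s)
    (hd : TargetsValid v s.d) :
    Wp v .pass M fun t M' => t ≤ passTime n m ∧ ∃ s' : State n m, Repr M' s' ∧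
      PassInvariant v w (∑ j, s.d j) 0 n s'.d s'.R s'.o s'.flag := by
  refine wp_seq (wp_const (wp_seq ((wp_fill_R (h.update_flag 0)).imp ?_)))
  rintro t₁ M₁ ⟨ht₁, h₁⟩
  refine wp_seq (wp_copy (by norm_num) ?_)
  rw [h₁.num_goods]
  refine (wp_countdown (v := v) (T := n * (m * (m + 22) + 22) + 7) (fun c M => c ≤ m ∧
    ∃ s' : State n m, s'.lvl = c ∧ Repr M s' ∧
      PassInvariant v w (∑ j, s.d j) c n s'.d s'.R s'.o s'.flag) ?_ ?_ m _
    ⟨le_rfl, _, rfl, (h₁.update_temp (.inl rfl) 0).update_lvl m, .start hd s.o⟩).imp ?_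
  · rintro c M ⟨-, s', hlvl, hM, -⟩
    rw [hM.lvl, hlvl]
  · rintro c M ⟨hc, s', hlvl, hM, hinv⟩
    have e : M 1 + M 2 = m + 1 := by rw [hM.num_goods, hM.one]
    -- The threshold cell is written twice, first with `m + 1` and then with the level subtracted.
    -- As the level counts down, the thresholds increase.
    have h₂ := (hM.update_thr (m + 1)).update_thr (m + 1 - (c + 1))
    refine wp_seq (wp_add (wp_seq (wp_sub (wp_seq ?_))))
    rw [Function.update_self, Function.update_of_ne (by norm_num : 8 ≠ 14), hM.lvl, hlvl, e]
    refine (wp_level hw hxos hc h₂ hlvl rfl hinv).imp ?_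
    rintro t₂ M₂ ⟨ht₂, s₂, hlvl₂, hinv₂, h₂⟩
    refine wp_sub ⟨by omega, by omega, _, ?_, h₂.update_lvl _, hinv₂.next_level⟩
    simp [h₂.lvl, h₂.one, hlvl₂]
  · rintro t M' ⟨ht, -, s', -, hM', hinv⟩
    refine ⟨?_, s', hM', hinv⟩
    rw [passTime]
    have : n * (m * (m + 22) + 22) + 7 + 1 = n * (m * (m + 22) + 22) + 8 := rfl
    rw [this] at ht
    have := Nat.mul_le_mul_left m (show n * (m * (m + 22) + 22) + 8 ≤ n * (m * (m + 22) + 22) + 10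
      by omega)
    omega

/-- The sum of `d` is a potential: it never exceeds `n * (m + 1)` and every pass that ends with a
raised flag increases it. The extra `1` in the variant pays for the successful last pass. -/
theorem wp_allocate (hn : 0 < n) (hw : ∀ i S, v i S = w i S) (hxos : ∀ i, IsUnitXOS (w i)) :
    Wp v .allocate (inputMemory n m) fun t M' =>
      t ≤ (n * (m + 1) + 1) * (passTime n m + 1) + n * 4 + 20 ∧
        ∃ s' : State n m, Repr M' s' ∧ TargetsValid v s'.d ∧
          ∀ j, m + 1 ≤ w j (takenBy s'.R s'.o j) + s'.d j := by
  refine wp_seq (wp_setup hn fun M₁ h₁ => wp_seq ((wp_forAgents (v := v) (T := 2)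
    (fun k s' => s'.agt = k ∧ ∀ j : Fin n, k ≤ (j : ℕ) → s'.d j = 1) (fun k s' hs => hs.1) ?_ h₁
    ⟨rfl, fun j hj => absurd j.isLt (by omega)⟩).imp ?_))
  · rintro i M s ⟨-, hd⟩ hM
    refine wp_setD hM i rfl (by norm_num) hM.one fun M' hM' => ⟨le_rfl, _, ⟨rfl, fun j hj => ?_⟩, hM'⟩
    by_cases e : j = i
    · simp [e]
    · simpa [e] using hd j (by have := Fin.val_ne_of_ne e; omega)
  rintro t₂ M₂ ⟨ht₂, s₂, ⟨-, hd₂⟩, h₂⟩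
  refine wp_seq (wp_const ((wp_loop (v := v) (T := passTime n m) (fun κ M => ∃ s : State n m,
    Repr M s ∧ TargetsValid v s.d ∧ (s.flag ≠ 0 → n * (m + 1) + 1 ≤ κ + ∑ j, s.d j) ∧
      (s.flag = 0 → ∀ j, m + 1 ≤ w j (takenBy s.R s.o j) + s.d j)) ?_ (n * (m + 1) + 1) _
    ⟨_, h₂.update_flag 1, ⟨fun j => ?_, fun j => ?_, fun j => ?_⟩, fun _ => by omega,
      fun h => absurd h one_ne_zero⟩).imp ?_))
  · rintro κ M ⟨s, hM, hvalid, hκ, -⟩ hx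
    have hκ' := hκ (hM.flag ▸ hx)
    have hsum : ∑ j, s.d j ≤ n * (m + 1) := by
      simpa using Finset.sum_le_card_nsmul Finset.univ s.d (m + 1) fun j _ => hvalid.le j
    refine (wp_pass hw hxos hM hvalid).imp ?_
    rintro t M' ⟨ht, s', hM', hinv⟩
    refine ⟨ht, κ - 1, by omega, s', hM', hinv.valid, fun hf => ?_, fun hf j => ?_⟩
    · have := hinv.sum_lt hf
      omega
    -- A pass ends at `c = 0`, and every `d j` is positive, so the invariant covers all agents.
    · exact hinv.served hf j (.inl (hinv.valid.pos j))
  · simp [hd₂ j]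
  · simp [hd₂ j]
  · have := APS_le_card (n := n) (hw j) (hxos j)
    have hm : (0 : ℝ) ≤ m := Nat.cast_nonneg m
    simp only [hd₂ j (Nat.zero_le _)]
    push_cast
    linarith
  · rintro t M' ⟨ht, h0, κ, s', hM', hvalid, -, hserved⟩
    exact ⟨by omega, s', hM', hvalid, hserved (hM'.flag ▸ h0)⟩

end Passes

/-! ### Output -/

namespace Program

/-- `M[y] := M[0] + y` for `1 ≤ y ≤ k`. -/
def addresses : ℕ → Program
  | 0 => .skip
  | k + 1 => .seq (addresses k) (.seq (.const (k + 1) (k + 1)) (.add (k + 1) (k + 1) 0))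

/-- `M[y] := M[M[y]]` for `y < k`. -/
def loads : ℕ → Program
  | 0 => .skip
  | k + 1 => .seq (loads k) (.load k k)

/-- Copy the owners of the goods from `16` on to their final place. -/
def outputHigh : Program :=
  .seq (.const 12 16) <| .seq (.sub 10 1 12) <| .loop 10 <| .seq (.sub 10 10 2) <|
    .seq (.add 15 10 12) <| .seq (.add 13 3 15) <| .seq (.load 13 13) (.store 15 13)

/-- Write the owners of all goods to their final place. This destroys the cells below `16`, so the
goods below `16` come last. -/
def output : Program := .seq outputHigh <| .seq (.copy 0 3) <| .seq (addresses 15) (loads 16)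

/-- Compute an allocation that gives every agent half their AnyPrice share. -/
def halfAPS : Program := .seq allocate output

end Program

section Output

variable {n m : ℕ} {v : Fin n → Valuation m} {M : Memory} {s : State n m}

theorem wp_addresses (k : ℕ) (M : Memory) :
    Wp v (.addresses k) M fun t M' => t = 2 * k + 1 ∧ M' 0 = M 0 ∧
      (∀ y, y ≤ k → y ≠ 0 → M' y = M 0 + y) ∧ ∀ y, k < y → M' y = M y := by
  induction k with
  | zero => exact wp_skip ⟨rfl, rfl, fun y hy h0 => by omega, fun y _ => rfl⟩
  | succ k ih =>
    refine wp_seq (ih.imp fun t M' ⟨ht, h0, h1, h2⟩ => wp_seq (wp_const (wp_add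
      ⟨by omega, ?_, fun y hy hy0 => ?_, fun y hy => ?_⟩)))
    · simp [h0]
    · by_cases e : y = k + 1
      · subst e
        simp [h0, add_comm]
      · simp [e, h1 y (by omega) hy0]
    · have e : y ≠ k + 1 := by omega
      simp [e, h2 y (by omega)]

/-- The hypothesis keeps all source addresses outside the block that is being overwritten, so the
order of the loads does not matter. -/
theorem wp_loads (k : ℕ) (M : Memory) (hM : ∀ y, y < k → k ≤ M y) :
    Wp v (.loads k) M fun t M' => t = k + 1 ∧ (∀ y, y < k → M' y = M (M y)) ∧
      ∀ y, k ≤ y → M' y = M y := by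
  suffices h : ∀ j, j ≤ k → Wp v (.loads j) M fun t M' => t = j + 1 ∧
      (∀ y, y < j → M' y = M (M y)) ∧ ∀ y, j ≤ y → M' y = M y from h k le_rfl
  intro j
  induction j with
  | zero => exact fun _ => wp_skip ⟨rfl, fun y hy => by omega, fun y _ => rfl⟩
  | succ j ih =>
    intro hj
    refine wp_seq ((ih (by omega)).imp fun t M' ⟨ht, h1, h2⟩ => wp_load
      ⟨by omega, fun y hy => ?_, fun y hy => ?_⟩)
    · by_cases e : y = j
      · subst e
        have := hM y (by omega)
        rw [Function.update_self, h2 y le_rfl, h2 _ (by omega)]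
      · rw [Function.update_of_ne e, h1 y (by omega)]
    · rw [Function.update_of_ne (by omega), h2 y (by omega)]

/-- The destinations lie below `m` and the owner array starts at `16 + m`, so no owner is
overwritten. For `m ≤ 16` the truncated difference `m - 16` is zero and nothing is copied. -/
theorem wp_outputHigh (h : Repr M s) :
    Wp v .outputHigh M fun t M' => t ≤ m * 7 + 3 ∧ M' 3 = 16 + m ∧
      (∀ g : Fin m, M' (16 + m + g) = s.o g) ∧ ∀ g : Fin m, 16 ≤ (g : ℕ) → M' g = s.o g := by
  refine wp_seq (wp_const (wp_seq (wp_sub ((wp_countdown (v := v) (T := 5) (fun k M =>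
    k ≤ m - 16 ∧ M 10 = k ∧ M 2 = 1 ∧ M 12 = 16 ∧ M 3 = 16 + m ∧
      (∀ g : Fin m, M (16 + m + g) = s.o g) ∧
      ∀ g : Fin m, 16 + k ≤ (g : ℕ) → M g = s.o g) (fun k M hM => hM.2.1) ?_ (m - 16) _
    ⟨le_rfl, ?_, ?_, ?_, ?_, fun g => ?_, fun g hg => absurd g.isLt (by omega)⟩).imp ?_))))
  · rintro k M ⟨hk, h10, h2, h12, h3, ho, hout⟩
    have hkm : k + 16 < m := by omega
    refine wp_seq (wp_sub (wp_seq (wp_add (wp_seq (wp_add (wp_seq (wp_load (wp_store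
      (a := k + 16) ?_ ?_))))))))
    · simp [h10, h2, h12]
    · have e := ho ⟨k + 16, hkm⟩
      have e' : ∀ a b c, Function.update (Function.update (Function.update M 10 a) 15 b) 13 c
          (16 + m + (k + 16)) = M (16 + m + (k + 16)) := fun a b c => by
        rw [Function.update_of_ne (by omega), Function.update_of_ne (by omega),
          Function.update_of_ne (by omega)]
      have hne : ∀ x, x < 16 → x ≠ k + 16 := by omega
      refine ⟨le_rfl, by omega, ?_, ?_, ?_, ?_, fun g => ?_, fun g hg => ?_⟩
      · simp [h10, h2]
      · simp [h2]
      · simp [h12]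
      · rw [Function.update_of_ne (hne _ (by norm_num))]
        simp [h3]
      · repeat rw [Function.update_of_ne (by omega)]
        exact ho g
      · by_cases eg : (g : ℕ) = k + 16
        · rw [eg, Function.update_self]
          simp only [Function.update_self, Function.update_of_ne, h10, h2, h12, h3, ne_eq,
            Nat.reduceEqDiff, not_false_eq_true, Nat.add_sub_cancel]
          rw [e', e]
          exact congrArg (fun g => (s.o g : ℕ)) (Fin.ext eg.symm)
        · repeat rw [Function.update_of_ne (by omega)]
          exact hout g (by omega)
  · simp [h.num_goods]
  · simp [h.one]
  · simp
  · simp [h.base_o]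
  · repeat rw [Function.update_of_ne (by omega)]
    exact h.o g
  · rintro t M' ⟨ht, -, -, -, -, h3, ho, hout⟩
    exact ⟨by omega, h3, ho, hout⟩

theorem wp_output (h : Repr M s) :
    Wp v .output M fun t M' => t ≤ m * 7 + 60 ∧ ∀ g : Fin m, M' g = s.o g := by
  refine wp_seq ((wp_outputHigh h).imp ?_)
  rintro t₁ M₁ ⟨ht₁, h3, ho, hout⟩
  refine wp_seq (wp_copy (by norm_num) (wp_seq ((wp_addresses 15 _).imp ?_)))
  rintro t₂ M₂ ⟨ht₂, h0, hlow, hhigh⟩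
  rw [Function.update_self, h3] at h0 hlow
  -- Each low cell first holds the address of its own owner entry. It can then be replaced by that
  -- entry without any auxiliary register.
  have haddr : ∀ y, y < 16 → M₂ y = 16 + m + y := by
    intro y hy
    by_cases e : y = 0
    · rw [e, h0, add_zero]
    · exact hlow y (by omega) e
  have hrest : ∀ y, 16 ≤ y → M₂ y = M₁ y := by
    intro y hy
    rw [hhigh y (by omega), Function.update_of_ne (by omega), Function.update_of_ne (by omega)]
  refine (wp_loads 16 M₂ fun y hy => by rw [haddr y hy]; omega).imp ?_
  rintro t₃ M₃ ⟨ht₃, h4, h5⟩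
  refine ⟨by omega, fun g => ?_⟩
  by_cases hg : (g : ℕ) < 16
  · rw [h4 g hg, haddr g hg, hrest _ (by omega), ho]
  · rw [h5 g (by omega), hrest g (by omega), hout g (by omega)]

end Output

/-- The algorithm computes a `1/2`-APS allocation. -/
theorem computesWithin_halfAPS {n m : ℕ} (hn : 0 < n) {v : Fin n → Valuation m}
    (hv : ∀ i, IsBinaryXOS (v i)) :
    ∃ A : Allocation n m, ComputesWithin .halfAPS v
      ((n * (m + 1) + 1) * (passTime n m + 1) + n * 4 + m * 7 + 80) A ∧
        IsAPSAllocation (1 / 2) v A := by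
  choose w hw hxos using fun i => (hv i).exists_nat
  obtain ⟨t₁, M₁, hr₁, ht₁, s, hM₁, hvalid, hserved⟩ :=
    wp_allocate (m := m) hn hw hxos
  obtain ⟨t₂, M₂, hr₂, ht₂, hout⟩ := wp_output (v := v) hM₁
  refine ⟨s.o, ⟨_, M₂, .seq hr₁ hr₂, by omega, hout⟩, fun i => ?_⟩
  -- Goods left in `R` go to whichever owner `o` happens to name, which by monotonicity does no
  -- harm.
  have h1 : w i (takenBy s.R s.o i) ≤ w i (bundle s.o i) := by
    refine (hxos i).mono fun g hg => ?_
    simp only [takenBy, Finset.mem_filter] at hg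
    simp [bundle, hg.2.2]
  have h2 : ((m + 1 : ℕ) : ℝ) ≤ (w i (bundle s.o i) + s.d i : ℕ) := by
    exact_mod_cast (hserved i).trans (Nat.add_le_add_right h1 _)
  have h3 := hvalid.aps i
  push_cast at h2
  rw [hw]
  linarith

theorem APS_nonneg {n m : ℕ} {v : Valuation m} (hv : IsBinaryXOS v) : 0 ≤ APS n v := by
  obtain ⟨w, hw, -⟩ := hv.exists_nat
  refine Real.sInf_nonneg ?_
  rintro z ⟨p, -, hz⟩
  obtain ⟨S, -, rfl⟩ := hz.1
  rw [hw]
  positivity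

end FairDivision

/-! ### Both parts of the theorem -/

open FairDivision in
theorem theorem3 :
    (∃ (c : FairDivision.Program) (P : Polynomial ℕ),
      ∀ (n m : ℕ) (v : Fin n → FairDivision.Valuation m), 0 < n →
        (∀ i, FairDivision.IsBinaryXOS (v i)) →
          ∃ A : FairDivision.Allocation n m,
            FairDivision.ComputesWithin c v (P.eval (n + m)) A ∧
              FairDivision.IsAPSAllocation 0.1222 v A) ∧
    (∃ (n m : ℕ) (u : FairDivision.Valuation m), 0 < n ∧ FairDivision.IsBinaryXOS u ∧
      ∀ (α : ℝ), 1 / 2 < α → ∀ A : FairDivision.Allocation n m,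
        ¬ FairDivision.IsAPSAllocation α (fun _ : Fin n => u) A) := by
  -- The polynomial is the time bound with both `n` and `m` replaced by `n + m`.
  refine ⟨⟨.halfAPS, (.X * (.X + 1) + 1) * (.X * (.X * (.X * (.X + 22) + 22) + 10) + .X * 4 + 10 + 1)
    + .X * 4 + .X * 7 + 80, fun n m v hn hv => ?_⟩, 3, 6, _, by norm_num, triangleRank_isBinaryXOS,
    fun α hα A => triangleRank_not_isAPSAllocation hα A⟩
  obtain ⟨A, ⟨t, M, hr, ht, hM⟩, hA⟩ := computesWithin_halfAPS hn hv
  refine ⟨A, ⟨t, M, hr, ht.trans ?_, hM⟩, fun i => le_trans ?_ (hA i)⟩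
  · have h1 : n ≤ n + m := by omega
    have h2 : m ≤ n + m := by omega
    simp only [Polynomial.eval_add, Polynomial.eval_mul, Polynomial.eval_X, Polynomial.eval_one,
      Polynomial.eval_ofNat, passTime]
    generalize n + m = N at *
    gcongr
  · exact mul_le_mul_of_nonneg_right (by norm_num) (APS_nonneg (hv i))
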